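/- An interior algebra is a Boolean algebra $B$ with an operator $g$ satisfying $g(1)=1$, $g(a\cdot b)=g(a)\cdot g(b)$, $g(a)\le a$ and $g(g(a))=g(a)$; $a$ is open if $g(a)=a$. The open elements of $B$ form a Heyting algebra $\mathcal O(B)$, a bounded sublattice of $B$ with implication $a\Rightarrow b=g(-a+b)$. $B$ is a $^*$-algebra if it is generated by its open elements, and a Grzegorczyk algebra if $g\bigl(x+f(x\cdot -g(x))\bigr)\le x$ for all $x\in B$, where $f(y)=-g(-y)$. A variety $\mathbf V$ of interior algebras is a $^*$-variety if it is generated, as a variety, by the $^*$-algebras it contains, and it is locally finite if finitely generated subalgebras of its members are finite. Let $\gamma(\mathbf V)$ be the class of all Heyting algebras isomorphic to $\mathcal O(B)$ for some $B\in\mathbf V$. Let $\mathbf K$ be $\mathbf V$ or $\gamma(\mathbf V)$, and let $A\in\mathbf K$ be finitely presented relative to $\mathbf K$. A unifier for $A$ in $\mathbf K$ is a homomorphism $u\colon A\to P$ with $P\in\mathbf K$ finitely presented and projective in $\mathbf K$ (projective with respect to surjective homomorphisms in $\mathbf K$). A unifier $u\colon A\to P$ is more general than $v\colon A\to Q$ if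 $v=h\circ u$ for some homomorphism $h\colon P\to Q$. $A$ is unifiable if it has a unifier. A $\mu$-set is a set $M$ of pairwise incomparable unifiers for $A$ such that for each unifier for $A$ some member of $M$ is more general than it. A unifiable $A$ has type $1$, $\omega$, $\infty$ or $0$ according to whether it has a $\mu$-set of cardinality $1$, a finite $\mu$-set of cardinality greater than $1$, an infinite $\mu$-set, or no $\mu$-set. With the order $1<\omega<\infty<0$, the unification type $t(\mathbf K)$ is the maximum of the types of the unifiable $A\in\mathbf K$. **Theorem.** Let $\mathbf V$ be a locally finite variety of interior algebras. Then $\mathbf V$ is a $^*$-variety if and only if all its members are Grzegorczyk algebras; and if $\mathbf V$ is a $^*$-variety, then $t(\mathbf V)=t(\gamma(\mathbf V))$. -/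

import Mathlib

open CategoryTheory

universe u

/-! ### Unification types of quasi-ordered sets -/

/-- The four unification types `1`, `ω`, `∞`, `0`. -/
inductive UnificationType : Type
  | unitary
  | finitary
  | infinitary
  | nullary

section Quasiorder

variable {P : Type*} [Preorder P]

/-- A `μ`-set of a quasi-ordered set: an antichain `M` which is dense, that is, each element
lies below some element of `M`. -/
def IsMuSet (M : Set P) : Prop :=
  IsAntichain (· ≤ ·) M ∧ ∀ x : P, ∃ m ∈ M, x ≤ m

/-- The quasi-ordered set `P` has the given unification type. -/
def QuasiorderHasType (P : Type*) [Preorder P] : UnificationType → Prop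
  | .unitary => ∃ M : Set P, IsMuSet M ∧ M.ncard = 1
  | .finitary => ∃ M : Set P, IsMuSet M ∧ M.Finite ∧ 1 < M.ncard
  | .infinitary => ∃ M : Set P, IsMuSet M ∧ M.Infinite
  | .nullary => ¬ ∃ M : Set P, IsMuSet M

theorem IsMuSet.exists_injective {M N : Set P} (hM : IsMuSet M) (hN : IsMuSet N) :
    ∃ f : N → M, Function.Injective f := by
  choose f hfM hf using fun n : N => hM.2 n
  refine ⟨fun n => ⟨f n, hfM n⟩, fun a b hab => ?_⟩
  have hab' : f a = f b := congrArg Subtype.val hab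
  obtain ⟨c, hc, hfc⟩ := hN.2 (f a)
  have h1 : (a : P) = c := hN.1.eq a.2 hc ((hf a).trans hfc)
  have h2 : (b : P) = c := hN.1.eq b.2 hc ((hf b).trans (hab' ▸ hfc))
  exact Subtype.ext (h1.trans h2.symm)

theorem IsMuSet.finite_of_finite {M N : Set P} (hM : IsMuSet M) (hN : IsMuSet N)
    (h : M.Finite) : N.Finite := by
  obtain ⟨f, hf⟩ := hM.exists_injective hN
  have := h.to_subtype
  exact Set.finite_coe_iff.1 (Finite.of_injective f hf)

theorem IsMuSet.ncard_le {M N : Set P} (hM : IsMuSet M) (hN : IsMuSet N)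
    (h : M.Finite) : N.ncard ≤ M.ncard := by
  obtain ⟨f, hf⟩ := hM.exists_injective hN
  have := h.to_subtype
  exact Nat.card_le_card_of_injective f hf

theorem QuasiorderHasType.unique {s t : UnificationType}
    (hs : QuasiorderHasType P s) (ht : QuasiorderHasType P t) : s = t := by
  cases s <;> cases t <;> simp only [QuasiorderHasType] at hs ht <;> first
    | rfl
    | (obtain ⟨M, hM, h⟩ := hs; exact absurd ⟨M, hM⟩ ht)
    | (obtain ⟨M, hM, h⟩ := ht; exact absurd ⟨M, hM⟩ hs)
    | (exfalso
       obtain ⟨M, hM, h⟩ := hs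
       obtain ⟨N, hN, k⟩ := ht
       first
        | (have := hM.ncard_le hN (Set.finite_of_ncard_ne_zero (by omega)); omega)
        | (have := hN.ncard_le hM (Set.finite_of_ncard_ne_zero (by omega)); omega)
        | exact k (hM.finite_of_finite hN (Set.finite_of_ncard_ne_zero (by omega)))
        | exact h (hN.finite_of_finite hM (Set.finite_of_ncard_ne_zero (by omega))))

theorem QuasiorderHasType.exists [Nonempty P] : ∃ t, QuasiorderHasType P t := by
  by_cases h : ∃ M : Set P, IsMuSet M
  · obtain ⟨M, hM⟩ := h
    by_cases hf : M.Finite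
    · have hne : M.Nonempty := by
        obtain ⟨m, hm, -⟩ := hM.2 (Classical.arbitrary P)
        exact ⟨m, hm⟩
      have hpos := (Set.ncard_pos hf).2 hne
      by_cases h1 : M.ncard = 1
      · exact ⟨.unitary, M, hM, h1⟩
      · exact ⟨.finitary, M, hM, hf, by omega⟩
    · exact ⟨.infinitary, M, hM, hf⟩
  · exact ⟨.nullary, h⟩

end Quasiorder

/-! ### Algebraic unification, for classes of algebras in a concrete category of algebras -/

/-- Terms over sets of variables, with their evaluation in the algebras of a concrete category. -/
class HasTerms (C : Type (u + 1)) [Category.{u} C] {FC : outParam (C → C → Type u)}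
    {CC : outParam (C → Type u)} [outParam (∀ X Y, FunLike (FC X Y) (CC X) (CC Y))]
    [ConcreteCategory C FC] where
  Term : Type → Type
  eval : (A : C) → {X : Type} → (X → CC A) → Term X → CC A

section Unification

variable {C : Type (u + 1)} [Category.{u} C] {FC : C → C → Type u} {CC : C → Type u}
  [∀ X Y, FunLike (FC X Y) (CC X) (CC Y)] [ConcreteCategory C FC]

/-- `P` is projective in the class `V`: `P` belongs to `V`, and each homomorphism from `P` to a
member of `V` lifts along each surjective homomorphism between members of `V`. -/
def IsProjectiveIn (V : Set C) (P : C) : Prop :=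
  P ∈ V ∧ ∀ A ∈ V, ∀ B ∈ V, ∀ (e : A ⟶ B) (f : P ⟶ B),
    Function.Surjective (ConcreteCategory.hom e) → ∃ g : P ⟶ A, g ≫ e = f

variable [HasTerms C]

/-- The tuple `a` satisfies all equations of `E`. -/
def Satisfies (A : C) {X : Type} (a : X → CC A)
    (E : Set (HasTerms.Term C X × HasTerms.Term C X)) : Prop :=
  ∀ p ∈ E, HasTerms.eval A a p.1 = HasTerms.eval A a p.2

/-- `A` is finitely presented relative to `V`: it belongs to `V` and is the algebra presented in
`V` by finitely many generators `a 0, …, a (n - 1)` and a finite set `E` of relations. -/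
def IsFinitelyPresentedIn (V : Set C) (A : C) : Prop :=
  A ∈ V ∧ ∃ (n : ℕ) (E : Set (HasTerms.Term C (Fin n) × HasTerms.Term C (Fin n)))
    (a : Fin n → CC A), E.Finite ∧ Satisfies A a E ∧
      ∀ B ∈ V, ∀ b : Fin n → CC B, Satisfies B b E →
        ∃! h : A ⟶ B, ∀ i, ConcreteCategory.hom h (a i) = b i

/-- A unifier for `A` in `V`: a homomorphism from `A` to an algebra which is finitely presented
and projective in `V`. -/
structure Unifier (V : Set C) (A : C) where
  target : C
  finitelyPresented : IsFinitelyPresentedIn V target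
  projective : IsProjectiveIn V target
  hom : A ⟶ target

/-- The quasi-order of unifiers: `u ≤ v` if `v` is more general than `u`, that is, if `u`
factors through `v`. -/
instance (V : Set C) (A : C) : Preorder (Unifier V A) where
  le u v := ∃ h : v.target ⟶ u.target, v.hom ≫ h = u.hom
  le_refl u := ⟨𝟙 _, Category.comp_id _⟩
  le_trans := by
    rintro u v w ⟨h, hh⟩ ⟨k, hk⟩
    exact ⟨k ≫ h, by rw [← Category.assoc, hk, hh]⟩

/-- `A` is unifiable relative to `V`; this is only considered for algebras `A` which are finitely
presented relative to `V`. -/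
def IsUnifiableIn (V : Set C) (A : C) : Prop :=
  IsFinitelyPresentedIn V A ∧ Nonempty (Unifier V A)

/-- The class `V` has the given unification type. -/
def HasUnificationType (V : Set C) : UnificationType → Prop
  | .unitary => ∀ A, IsUnifiableIn V A → QuasiorderHasType (Unifier V A) .unitary
  | .finitary =>
      (∀ A, IsUnifiableIn V A → QuasiorderHasType (Unifier V A) .unitary ∨
        QuasiorderHasType (Unifier V A) .finitary) ∧
      ∃ A, IsUnifiableIn V A ∧ QuasiorderHasType (Unifier V A) .finitary
  | .infinitary =>
      (∀ A, IsUnifiableIn V A → QuasiorderHasType (Unifier V A) .unitary ∨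
        QuasiorderHasType (Unifier V A) .finitary ∨
        QuasiorderHasType (Unifier V A) .infinitary) ∧
      ∃ A, IsUnifiableIn V A ∧ QuasiorderHasType (Unifier V A) .infinitary
  | .nullary => ∃ A, IsUnifiableIn V A ∧ QuasiorderHasType (Unifier V A) .nullary

theorem HasUnificationType.existsUnique (V : Set C) : ∃! t, HasUnificationType V t := by
  have ex : ∀ A, IsUnifiableIn V A → ∃ t, QuasiorderHasType (Unifier V A) t := fun A hA =>
    haveI := hA.2
    QuasiorderHasType.exists
  have un : ∀ A s t, QuasiorderHasType (Unifier V A) s → QuasiorderHasType (Unifier V A) t →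
      s = t := fun A s t h k => h.unique k
  refine existsUnique_of_exists_of_unique ?_ ?_
  · by_cases h0 : HasUnificationType V .nullary
    · exact ⟨_, h0⟩
    by_cases h1 : ∃ A, IsUnifiableIn V A ∧ QuasiorderHasType (Unifier V A) .infinitary
    · refine ⟨.infinitary, fun A hA => ?_, h1⟩
      obtain ⟨t, ht⟩ := ex A hA
      cases t
      · exact Or.inl ht
      · exact Or.inr (Or.inl ht)
      · exact Or.inr (Or.inr ht)
      · exact absurd ⟨A, hA, ht⟩ h0
    by_cases h2 : ∃ A, IsUnifiableIn V A ∧ QuasiorderHasType (Unifier V A) .finitary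
    · refine ⟨.finitary, fun A hA => ?_, h2⟩
      obtain ⟨t, ht⟩ := ex A hA
      cases t
      · exact Or.inl ht
      · exact Or.inr ht
      · exact absurd ⟨A, hA, ht⟩ h1
      · exact absurd ⟨A, hA, ht⟩ h0
    · refine ⟨.unitary, fun A hA => ?_⟩
      obtain ⟨t, ht⟩ := ex A hA
      cases t
      · exact ht
      · exact absurd ⟨A, hA, ht⟩ h2
      · exact absurd ⟨A, hA, ht⟩ h1
      · exact absurd ⟨A, hA, ht⟩ h0
  · intro s t hs ht
    cases s <;> cases t <;> simp only [HasUnificationType] at hs ht <;> grind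

/-- The unification type `t(V)` of the class `V`. -/
noncomputable def unificationType (V : Set C) : UnificationType :=
  Classical.choose (HasUnificationType.existsUnique V).exists

theorem unificationType_eq_iff (V : Set C) (t : UnificationType) :
    unificationType V = t ↔ HasUnificationType V t :=
  have h := Classical.choose_spec (HasUnificationType.existsUnique V).exists
  ⟨fun e => e ▸ h, fun k => (HasUnificationType.existsUnique V).unique h k⟩

end Unification

/-! ### Terms in the language of Heyting algebras -/

inductive HeytTerm (X : Type) : Type
  | var : X → HeytTerm X
  | bot : HeytTerm X
  | top : HeytTerm X
  | inf : HeytTerm X → HeytTerm X → HeytTerm X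
  | sup : HeytTerm X → HeytTerm X → HeytTerm X
  | imp : HeytTerm X → HeytTerm X → HeytTerm X

def HeytTerm.eval {L : Type u} [HeytingAlgebra L] {X : Type} (a : X → L) : HeytTerm X → L
  | .var x => a x
  | .bot => ⊥
  | .top => ⊤
  | .inf s t => s.eval a ⊓ t.eval a
  | .sup s t => s.eval a ⊔ t.eval a
  | .imp s t => s.eval a ⇨ t.eval a

instance : HasTerms HeytAlg.{u} where
  Term := HeytTerm
  eval _ _ a t := HeytTerm.eval a t

/-! ### Interior algebras -/

/-- An interior algebra: a Boolean algebra with an interior operator. -/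
class InteriorAlgebra (B : Type u) extends BooleanAlgebra B where
  int : B → B
  int_top : int ⊤ = ⊤
  int_inf : ∀ a b, int (a ⊓ b) = int a ⊓ int b
  int_le : ∀ a, int a ≤ a
  int_int : ∀ a, int (int a) = int a

/-- Homomorphisms of interior algebras. -/
@[ext]
structure InteriorHom (A B : Type u) [InteriorAlgebra A] [InteriorAlgebra B] where
  toFun : A → B
  map_bot : toFun ⊥ = ⊥
  map_top : toFun ⊤ = ⊤
  map_inf : ∀ a b, toFun (a ⊓ b) = toFun a ⊓ toFun b
  map_sup : ∀ a b, toFun (a ⊔ b) = toFun a ⊔ toFun b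
  map_compl : ∀ a, toFun aᶜ = (toFun a)ᶜ
  map_int : ∀ a, toFun (InteriorAlgebra.int a) = InteriorAlgebra.int (toFun a)

instance (A B : Type u) [InteriorAlgebra A] [InteriorAlgebra B] :
    FunLike (InteriorHom A B) A B where
  coe f := f.toFun
  coe_injective _ _ h := InteriorHom.ext h

/-- The category `IA` of interior algebras. -/
structure IntAlg : Type (u + 1) where
  carrier : Type u
  [str : InteriorAlgebra carrier]

attribute [instance] IntAlg.str

instance : CoeSort IntAlg.{u} (Type u) := ⟨IntAlg.carrier⟩

instance : Category.{u} IntAlg.{u} where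
  Hom A B := InteriorHom A B
  id _ :=
    { toFun := id
      map_bot := rfl
      map_top := rfl
      map_inf := fun _ _ => rfl
      map_sup := fun _ _ => rfl
      map_compl := fun _ => rfl
      map_int := fun _ => rfl }
  comp f g :=
    { toFun := g.toFun ∘ f.toFun
      map_bot := by simp [f.map_bot, g.map_bot]
      map_top := by simp [f.map_top, g.map_top]
      map_inf := by simp [f.map_inf, g.map_inf]
      map_sup := by simp [f.map_sup, g.map_sup]
      map_compl := by simp [f.map_compl, g.map_compl]
      map_int := by simp [f.map_int, g.map_int] }

instance : ConcreteCategory IntAlg.{u} (fun A B => InteriorHom A B) where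
  hom f := f
  ofHom f := f
  hom_ofHom _ := rfl
  ofHom_hom _ := rfl
  id_apply _ := rfl
  comp_apply _ _ _ := rfl

inductive IntTerm (X : Type) : Type
  | var : X → IntTerm X
  | bot : IntTerm X
  | top : IntTerm X
  | inf : IntTerm X → IntTerm X → IntTerm X
  | sup : IntTerm X → IntTerm X → IntTerm X
  | compl : IntTerm X → IntTerm X
  | int : IntTerm X → IntTerm X

def IntTerm.eval {B : Type u} [InteriorAlgebra B] {X : Type} (a : X → B) : IntTerm X → B
  | .var x => a x
  | .bot => ⊥
  | .top => ⊤
  | .inf s t => s.eval a ⊓ t.eval a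
  | .sup s t => s.eval a ⊔ t.eval a
  | .compl t => (t.eval a)ᶜ
  | .int t => InteriorAlgebra.int (t.eval a)

instance : HasTerms IntAlg.{u} where
  Term := IntTerm
  eval _ _ a t := IntTerm.eval a t

/-- Direct products of interior algebras, with all operations computed coordinatewise. -/
instance {I : Type u} (B : I → Type u) [∀ i, InteriorAlgebra (B i)] :
    InteriorAlgebra (∀ i, B i) where
  int a i := InteriorAlgebra.int (a i)
  int_top := funext fun _ => InteriorAlgebra.int_top
  int_inf _ _ := funext fun _ => InteriorAlgebra.int_inf _ _
  int_le _ _ := InteriorAlgebra.int_le _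
  int_int _ := funext fun _ => InteriorAlgebra.int_int _

namespace InteriorAlgebra

variable {B : Type u} [InteriorAlgebra B]

/-- `S` is (the universe of) a subalgebra of the interior algebra `B`. -/
structure IsSubalgebra (S : Set B) : Prop where
  bot_mem : ⊥ ∈ S
  top_mem : ⊤ ∈ S
  inf_mem : ∀ a ∈ S, ∀ b ∈ S, a ⊓ b ∈ S
  sup_mem : ∀ a ∈ S, ∀ b ∈ S, a ⊔ b ∈ S
  compl_mem : ∀ a ∈ S, aᶜ ∈ S
  int_mem : ∀ a ∈ S, int a ∈ S

/-- The subalgebra generated by `s`. -/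
def generated (s : Set B) : Set B := ⋂₀ {S | IsSubalgebra S ∧ s ⊆ S}

theorem int_mono {a b : B} (h : a ≤ b) : int a ≤ int b := by
  have := int_inf a b
  rw [inf_eq_left.2 h] at this
  exact inf_eq_left.1 this.symm

/-- The set of open elements. -/
def opens (B : Type u) [InteriorAlgebra B] : Set B := {a | int a = a}

theorem int_mem_opens (a : B) : int a ∈ opens B := int_int a

theorem sup_mem_opens {a b : B} (ha : a ∈ opens B) (hb : b ∈ opens B) : a ⊔ b ∈ opens B := by
  refine le_antisymm (int_le _) (sup_le ?_ ?_)
  · calc a = int a := ha.symm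
      _ ≤ int (a ⊔ b) := int_mono le_sup_left
  · calc b = int b := hb.symm
      _ ≤ int (a ⊔ b) := int_mono le_sup_right

theorem inf_mem_opens {a b : B} (ha : a ∈ opens B) (hb : b ∈ opens B) : a ⊓ b ∈ opens B := by
  change int (a ⊓ b) = a ⊓ b
  rw [int_inf, show int a = a from ha, show int b = b from hb]

/-- The Heyting algebra of open elements: a bounded sublattice of `B`, with the implication
`a ⇨ b = int (aᶜ ⊔ b)`. -/
instance : HeytingAlgebra (opens B) where
  __ := (inferInstance : PartialOrder (opens B))
  sup a b := ⟨(a : B) ⊔ (b : B), sup_mem_opens a.2 b.2⟩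
  inf a b := ⟨(a : B) ⊓ (b : B), inf_mem_opens a.2 b.2⟩
  le_sup_left a b := (le_sup_left : (a : B) ≤ (a : B) ⊔ (b : B))
  le_sup_right a b := (le_sup_right : (b : B) ≤ (a : B) ⊔ (b : B))
  sup_le a b c h k := (sup_le h k : (a : B) ⊔ b ≤ c)
  inf_le_left a b := (inf_le_left : (a : B) ⊓ b ≤ a)
  inf_le_right a b := (inf_le_right : (a : B) ⊓ b ≤ b)
  le_inf a b c h k := (le_inf h k : (a : B) ≤ (b : B) ⊓ (c : B))
  top := ⟨⊤, int_top⟩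
  le_top a := (le_top : (a : B) ≤ ⊤)
  bot := ⟨⊥, le_antisymm (int_le _) bot_le⟩
  bot_le a := (bot_le : ⊥ ≤ (a : B))
  himp a b := ⟨int ((a : B)ᶜ ⊔ b), int_mem_opens _⟩
  le_himp_iff a b c := by
    change (a : B) ≤ int ((b : B)ᶜ ⊔ c) ↔ (a : B) ⊓ b ≤ c
    have key : (a : B) ≤ (b : B)ᶜ ⊔ c ↔ (a : B) ⊓ b ≤ c := by
      rw [sup_comm, ← himp_eq, le_himp_iff]
    rw [← key]
    refine ⟨fun h => h.trans (int_le _), fun h => ?_⟩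
    calc (a : B) = int (a : B) := a.2.symm
      _ ≤ _ := int_mono h
  compl a := ⟨int (a : B)ᶜ, int_mem_opens _⟩
  himp_bot a := Subtype.ext (congrArg int (sup_bot_eq (a : B)ᶜ))

/-- `B` is a `*`-algebra: it is generated by its open elements. -/
def IsStarAlgebra (B : Type u) [InteriorAlgebra B] : Prop := generated (opens B) = Set.univ

/-- `B` is a Grzegorczyk algebra: `int (x ⊔ cl (x ⊓ (int x)ᶜ)) ≤ x` for all `x`, where
`cl y = (int yᶜ)ᶜ` is the closure operator. -/
def IsGrzegorczyk (B : Type u) [InteriorAlgebra B] : Prop :=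
  ∀ x : B, int (x ⊔ (int (x ⊓ (int x)ᶜ)ᶜ)ᶜ) ≤ x

end InteriorAlgebra

namespace IntAlg

open InteriorAlgebra

/-- A variety of interior algebras: a class closed under homomorphic images, (isomorphic copies
of) subalgebras and direct products. -/
structure IsVariety (V : Set IntAlg.{u}) : Prop where
  image_mem : ∀ A ∈ V, ∀ (B : IntAlg.{u}) (f : A ⟶ B),
    Function.Surjective (ConcreteCategory.hom f) → B ∈ V
  sub_mem : ∀ A ∈ V, ∀ (B : IntAlg.{u}) (f : B ⟶ A),
    Function.Injective (ConcreteCategory.hom f) → B ∈ V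
  prod_mem : ∀ (I : Type u) (A : I → IntAlg.{u}), (∀ i, A i ∈ V) →
    (⟨∀ i, A i⟩ : IntAlg.{u}) ∈ V

/-- The variety generated by the class `K`. -/
def varietyGenerated (K : Set IntAlg.{u}) : Set IntAlg.{u} :=
  ⋂₀ {W | IsVariety W ∧ K ⊆ W}

/-- `V` is a `*`-variety: it is generated by the `*`-algebras it contains. -/
def IsStarVariety (V : Set IntAlg.{u}) : Prop :=
  IsVariety V ∧ V = varietyGenerated {A | A ∈ V ∧ IsStarAlgebra A}

/-- `V` is locally finite: finitely generated subalgebras of its members are finite. -/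
def IsLocallyFinite (V : Set IntAlg.{u}) : Prop :=
  ∀ A ∈ V, ∀ s : Set A, s.Finite → (generated s).Finite

/-- The Heyting algebra `O(A)` of open elements of `A`. -/
def openAlgebra (A : IntAlg.{u}) : HeytAlg.{u} := HeytAlg.of (opens A)

/-- The class `γ(V) = O[V]` of Heyting algebras (closed under isomorphism). -/
def gamma (V : Set IntAlg.{u}) : Set HeytAlg.{u} :=
  {L | ∃ A ∈ V, Nonempty (L ≅ openAlgebra A)}

end IntAlg

/-!
A `*`-algebra is generated by its open elements already as a Boolean algebra. So each of its
elements is resolvable in the sense of Kuratowski, and the Grzegorczyk inequality for `x` follows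
because `x` and its complement then have no mutually dense nonzero parts; the inequality passes to
the variety generated. Conversely, in a Grzegorczyk algebra each atom `a` satisfies
`a = cl a \ cl (cl a \ a)`, so a finite Grzegorczyk algebra is generated by its open elements, and
for the members of a locally finite variety it suffices to look at one-generated subalgebras.

For unification, the functor `O` is full and faithful on `*`-algebras: the Boolean algebra
generated by the graph of a homomorphism `O(A) → O(B)` has no open elements besides those in the
graph, by a lemma of McKinsey and Tarski, and is therefore the graph of a homomorphism `A → B`.
By local finiteness, being finitely presented amounts to being finite in both classes, and `A` is
finite if and only if `O(A)` is. So `O` is an equivalence between the `*`-variety `V` and `γ(V)`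
which preserves finite presentability and surjectivity, hence also projectivity, unifiers and
their order.
-/

namespace InteriorAlgebra

section Opens

variable {B : Type u} [InteriorAlgebra B]

theorem bot_mem_opens : (⊥ : B) ∈ opens B := le_antisymm (int_le _) bot_le

theorem top_mem_opens : (⊤ : B) ∈ opens B := int_top

theorem isSublattice_opens : IsSublattice (opens B) where
  supClosed _ ha _ hb := sup_mem_opens ha hb
  infClosed _ ha _ hb := inf_mem_opens ha hb

theorem isSubalgebra_generated (s : Set B) : IsSubalgebra (generated s) where
  bot_mem _ h := h.1.bot_mem
  top_mem _ h := h.1.top_mem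
  inf_mem a ha b hb S h := h.1.inf_mem a (ha S h) b (hb S h)
  sup_mem a ha b hb S h := h.1.sup_mem a (ha S h) b (hb S h)
  compl_mem a ha S h := h.1.compl_mem a (ha S h)
  int_mem a ha S h := h.1.int_mem a (ha S h)

theorem subset_generated (s : Set B) : s ⊆ generated s := fun _ ha _ h => h.2 ha

/-- A subalgebra as a Boolean subalgebra. -/
def IsSubalgebra.toBooleanSubalgebra {S : Set B} (hS : IsSubalgebra S) : BooleanSubalgebra B where
  carrier := S
  supClosed' a ha b hb := hS.sup_mem a ha b hb
  infClosed' a ha b hb := hS.inf_mem a ha b hb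
  compl_mem' ha := hS.compl_mem _ ha
  bot_mem' := hS.bot_mem

theorem isSubalgebra_closure_opens :
    IsSubalgebra (BooleanSubalgebra.closure (opens B) : Set B) where
  bot_mem := BooleanSubalgebra.bot_mem
  top_mem := BooleanSubalgebra.top_mem
  inf_mem _ ha _ hb := BooleanSubalgebra.inf_mem ha hb
  sup_mem _ ha _ hb := BooleanSubalgebra.sup_mem ha hb
  compl_mem _ ha := BooleanSubalgebra.compl_mem ha
  int_mem a _ := BooleanSubalgebra.subset_closure (int_mem_opens a)

theorem isStarAlgebra_iff_closure_opens :
    IsStarAlgebra B ↔ ∀ x : B, x ∈ BooleanSubalgebra.closure (opens B) := by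
  refine ⟨fun hB x => ?_, fun hB => Set.eq_univ_of_forall fun x S hS => ?_⟩
  · have hx : x ∈ generated (opens B) := hB ▸ Set.mem_univ x
    exact hx _ ⟨isSubalgebra_closure_opens, BooleanSubalgebra.subset_closure⟩
  · have hle : BooleanSubalgebra.closure (opens B) ≤ hS.1.toBooleanSubalgebra :=
      BooleanSubalgebra.closure_le.2 hS.2
    exact hle (hB x)

@[elab_as_elim]
theorem IsStarAlgebra.induction {p : B → Prop} (hB : IsStarAlgebra B)
    (mem_opens : ∀ a ∈ opens B, p a) (compl : ∀ a, p a → p aᶜ)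
    (sup : ∀ a b, p a → p b → p (a ⊔ b)) (x : B) : p x :=
  BooleanSubalgebra.closure_bot_sup_induction (p := fun x _ => p x) mem_opens
    (mem_opens ⊥ bot_mem_opens) (fun a _ b _ => sup a b) (fun a _ => compl a)
    (isStarAlgebra_iff_closure_opens.1 hB x)

theorem IsStarAlgebra.finite [Finite (opens B)] (hB : IsStarAlgebra B) : Finite B := by
  refine Finite.of_surjective
    (fun t : Finset (opens B × opens B) => t.sup fun x => (x.1 : B) \ x.2) fun x => ?_
  obtain ⟨t, ht⟩ := (BooleanSubalgebra.mem_closure_iff_sup_sdiff isSublattice_opens bot_mem_opens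
    top_mem_opens).1 (isStarAlgebra_iff_closure_opens.1 hB x)
  exact ⟨t, ht.symm⟩

theorem IsStarAlgebra.finite_opens_iff (hB : IsStarAlgebra B) : Finite (opens B) ↔ Finite B :=
  ⟨fun _ => hB.finite, fun _ => Subtype.finite⟩

end Opens

section Resolvable

variable {B : Type u} [InteriorAlgebra B] {x y : B}

/-- The closure operator of an interior algebra. -/
def cl (x : B) : B := (int xᶜ)ᶜ

theorem le_cl (x : B) : x ≤ cl x := le_compl_comm.1 (int_le _)

theorem cl_bot : cl (⊥ : B) = ⊥ := by simp only [cl, compl_bot, int_top, compl_top]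

theorem disjoint_cl_right (hx : x ∈ opens B) (h : Disjoint x y) : Disjoint x (cl y) := by
  rw [cl, disjoint_compl_right_iff, ← show int x = x from hx]
  exact int_mono h.le_compl_right

theorem inf_cl_le (hx : x ∈ opens B) (y : B) : x ⊓ cl y ≤ cl (x ⊓ y) := by
  have hdisj : Disjoint (x ⊓ int (x ⊓ y)ᶜ) y := by
    rw [disjoint_right_comm]
    exact disjoint_compl_right.mono_right (int_le _)
  have hcl := disjoint_cl_right (inf_mem_opens hx (int_mem_opens _)) hdisj
  rw [disjoint_right_comm] at hcl
  exact hcl.le_compl_right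

/-- Kuratowski's resolvable sets, for an element of an interior algebra: each nonzero `e` has a
nonzero relatively open part lying inside `x` or inside the complement of `x`. -/
def IsResolvable (x : B) : Prop :=
  ∀ e ≠ ⊥, ∃ v ∈ opens B, e ⊓ v ≠ ⊥ ∧ (e ⊓ v ≤ x ∨ e ⊓ v ≤ xᶜ)

theorem isResolvable_of_mem_opens (hx : x ∈ opens B) : IsResolvable x := by
  intro e he
  by_cases h : Disjoint e x
  · exact ⟨⊤, top_mem_opens, by rwa [inf_top_eq], .inr (inf_le_left.trans h.le_compl_right)⟩
  · exact ⟨x, hx, fun h' => h (disjoint_iff.2 h'), .inl inf_le_right⟩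

theorem IsResolvable.compl (hx : IsResolvable x) : IsResolvable xᶜ := by
  intro e he
  obtain ⟨v, hv, hne, h⟩ := hx e he
  exact ⟨v, hv, hne, by rwa [compl_compl, or_comm]⟩

theorem IsResolvable.inf (hx : IsResolvable x) (hy : IsResolvable y) : IsResolvable (x ⊓ y) := by
  intro e he
  obtain ⟨v, hv, hne, hle | hle⟩ := hx e he
  · obtain ⟨w, hw, hne', h⟩ := hy _ hne
    rw [inf_assoc] at hne' h
    refine ⟨v ⊓ w, inf_mem_opens hv hw, hne', h.imp (fun h => le_inf ?_ h) fun h => ?_⟩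
    · exact (inf_le_inf_left e inf_le_left).trans hle
    · exact h.trans (compl_le_compl inf_le_right)
  · exact ⟨v, hv, hne, .inr (hle.trans (compl_le_compl inf_le_left))⟩

theorem IsResolvable.sup (hx : IsResolvable x) (hy : IsResolvable y) : IsResolvable (x ⊔ y) := by
  simpa only [compl_inf, compl_compl] using (hx.compl.inf hy.compl).compl

theorem IsStarAlgebra.isResolvable (hB : IsStarAlgebra B) (x : B) : IsResolvable x :=
  hB.induction (fun _ => isResolvable_of_mem_opens) (fun _ => .compl) (fun _ _ => .sup) x

/-- The relatively open part of `p ⊔ q` that avoids `p`, say, avoids the closure of `p` as well,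
and hence avoids `q`. -/
theorem IsResolvable.sup_eq_bot_of_le_cl (hx : IsResolvable x) {p q : B} (hp : p ≤ xᶜ) (hq : q ≤ x)
    (hpq : p ≤ cl q) (hqp : q ≤ cl p) : p ⊔ q = ⊥ := by
  by_contra hne
  obtain ⟨v, hv, hne, hle⟩ := hx _ hne
  rw [inf_comm] at hne hle
  refine hne (disjoint_iff.1 (disjoint_sup_right.2 ?_))
  rcases hle with hle | hle
  · have hvp : Disjoint v p := by
      simpa only [disjoint_assoc, inf_of_le_right, le_sup_left] using
        disjoint_compl_right.mono hle hp
    exact ⟨hvp, (disjoint_cl_right hv hvp).mono_right hqp⟩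
  · have hvq : Disjoint v q := by
      simpa only [disjoint_assoc, inf_of_le_right, le_sup_right] using
        disjoint_compl_left.mono hle hq
    exact ⟨(disjoint_cl_right hv hvq).mono_right hpq, hvq⟩

theorem IsResolvable.int_sup_cl_le (hx : IsResolvable x) :
    int (x ⊔ cl (x ⊓ (int x)ᶜ)) ≤ x := by
  set q := x ⊓ (int x)ᶜ
  set y := int (x ⊔ cl q)
  have hy : y ∈ opens B := int_mem_opens _
  have hdense : y ⊓ xᶜ ≤ cl (y ⊓ q) := by
    refine (le_inf inf_le_left ?_).trans (inf_cl_le hy q)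
    rw [← sdiff_eq, sdiff_le_iff]
    exact int_le _
  have hdense' : y ⊓ q ≤ cl (y ⊓ xᶜ) := by
    refine (inf_le_inf_left y ?_).trans (inf_cl_le hy xᶜ)
    rw [cl, compl_compl]
    exact inf_le_right
  have hbot := hx.sup_eq_bot_of_le_cl inf_le_right (inf_le_right.trans inf_le_left) hdense hdense'
  exact sdiff_eq_bot_iff.1 (sdiff_eq.trans (sup_eq_bot_iff.1 hbot).1)

theorem IsStarAlgebra.isGrzegorczyk (hB : IsStarAlgebra B) : IsGrzegorczyk B :=
  fun x => (hB.isResolvable x).int_sup_cl_le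

end Resolvable

section Grzegorczyk

variable {B : Type u} [InteriorAlgebra B]

theorem cl_mem_closure_opens (x : B) : cl x ∈ BooleanSubalgebra.closure (opens B) :=
  BooleanSubalgebra.compl_mem (BooleanSubalgebra.subset_closure (int_mem_opens _))

theorem IsGrzegorczyk.le_cl_sdiff (hB : IsGrzegorczyk B) (x : B) :
    x ≤ cl (x \ cl (cl x \ x)) := by
  have h := compl_le_compl (hB xᶜ)
  rw [compl_compl] at h
  rwa [cl, compl_sdiff, himp_eq, sup_comm, sdiff_eq, inf_comm]

theorem IsGrzegorczyk.eq_cl_sdiff_of_isAtom (hB : IsGrzegorczyk B) {a : B} (ha : IsAtom a) :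
    a = cl a \ cl (cl a \ a) := by
  have hdisj : Disjoint a (cl (cl a \ a)) := by
    rw [← ha.not_le_iff_disjoint]
    intro h
    have hle := hB.le_cl_sdiff a
    rw [sdiff_eq_bot_iff.2 h, cl_bot] at hle
    exact ha.1 (le_bot_iff.1 hle)
  exact le_antisymm (le_sdiff.2 ⟨le_cl a, hdisj⟩) (sdiff_le_comm.1 (le_cl _))

theorem IsGrzegorczyk.isStarAlgebra_of_finite [Finite B] (hB : IsGrzegorczyk B) :
    IsStarAlgebra B := by
  rw [isStarAlgebra_iff_closure_opens]
  intro x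
  induction x using WellFoundedLT.induction with
  | ind x ih =>
    rcases eq_bot_or_exists_atom_le x with rfl | ⟨a, ha, hax⟩
    · exact BooleanSubalgebra.bot_mem
    · have ha_mem : a ∈ BooleanSubalgebra.closure (opens B) := by
        rw [hB.eq_cl_sdiff_of_isAtom ha]
        exact BooleanSubalgebra.sdiff_mem (cl_mem_closure_opens _) (cl_mem_closure_opens _)
      rw [← sdiff_sup_cancel hax]
      exact BooleanSubalgebra.sup_mem (ih _ (sdiff_lt hax ha.1)) ha_mem

end Grzegorczyk

section Hom

variable {A B : Type u} [InteriorAlgebra A] [InteriorAlgebra B]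

instance : BoundedLatticeHomClass (InteriorHom A B) A B where
  map_sup f := f.map_sup
  map_inf f := f.map_inf
  map_top f := f.map_top
  map_bot f := f.map_bot

theorem map_int (f : InteriorHom A B) (a : A) : f (int a) = int (f a) := f.map_int a

theorem map_grzegorczyk (f : InteriorHom A B) (x : A) :
    f (int (x ⊔ (int (x ⊓ (int x)ᶜ)ᶜ)ᶜ)) = int (f x ⊔ (int (f x ⊓ (int (f x))ᶜ)ᶜ)ᶜ) := by
  simp only [map_int, map_sup, map_inf, map_compl']

theorem IsGrzegorczyk.of_surjective (hA : IsGrzegorczyk A) {f : InteriorHom A B}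
    (hf : Function.Surjective f) : IsGrzegorczyk B := by
  intro y
  obtain ⟨x, rfl⟩ := hf y
  rw [← map_grzegorczyk]
  exact OrderHomClass.mono f (hA x)

theorem IsGrzegorczyk.of_injective (hB : IsGrzegorczyk B) {f : InteriorHom A B}
    (hf : Function.Injective f) : IsGrzegorczyk A := by
  intro x
  have h := hB (f x)
  rw [← map_grzegorczyk] at h
  refine inf_eq_left.1 (hf ?_)
  rw [map_inf, inf_eq_left.2 h]

theorem mem_opens_of_map_mem_opens {f : InteriorHom A B} (hf : Function.Injective f) {a : A}
    (ha : f a ∈ opens B) : a ∈ opens A :=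
  hf ((map_int f a).trans ha)

end Hom

section Subalgebra

variable {B : Type u} [InteriorAlgebra B] {S : Set B}

instance (hS : IsSubalgebra S) : InteriorAlgebra hS.toBooleanSubalgebra where
  int a := ⟨int (a : B), hS.int_mem _ a.2⟩
  int_top := Subtype.ext int_top
  int_inf _ _ := Subtype.ext (int_inf _ _)
  int_le a := int_le (a : B)
  int_int _ := Subtype.ext (int_int _)

/-- The inclusion of a subalgebra. -/
def IsSubalgebra.incl (hS : IsSubalgebra S) : InteriorHom hS.toBooleanSubalgebra B where
  toFun := Subtype.val
  map_bot := rfl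
  map_top := rfl
  map_inf _ _ := rfl
  map_sup _ _ := rfl
  map_compl _ := rfl
  map_int _ := rfl

theorem IsSubalgebra.incl_injective (hS : IsSubalgebra S) : Function.Injective hS.incl :=
  Subtype.val_injective

theorem IsGrzegorczyk.isStarAlgebra (hB : IsGrzegorczyk B)
    (hfin : ∀ x : B, (generated {x}).Finite) : IsStarAlgebra B := by
  rw [isStarAlgebra_iff_closure_opens]
  intro x
  have hS := isSubalgebra_generated ({x} : Set B)
  have : Finite hS.toBooleanSubalgebra := (hfin x).to_subtype
  have hstar : IsStarAlgebra hS.toBooleanSubalgebra :=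
    (hB.of_injective hS.incl_injective).isStarAlgebra_of_finite
  suffices ∀ y : hS.toBooleanSubalgebra, (y : B) ∈ BooleanSubalgebra.closure (opens B) from
    this ⟨x, subset_generated _ rfl⟩
  exact hstar.induction
    (fun a ha => BooleanSubalgebra.subset_closure (congrArg Subtype.val ha : int (a : B) = a))
    (fun _ => BooleanSubalgebra.compl_mem) (fun _ _ => BooleanSubalgebra.sup_mem)

end Subalgebra

section OpenHom

variable {A B : Type u} [InteriorAlgebra A] [InteriorAlgebra B]

/-- The Heyting algebra homomorphism obtained by restricting a homomorphism of interior algebras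
to the open elements; the action of `O` on homomorphisms. -/
def openHom (f : InteriorHom A B) : HeytingHom (opens A) (opens B) where
  toFun a := ⟨f a, (map_int f a).symm.trans (congrArg f a.2)⟩
  map_sup' _ _ := Subtype.ext (map_sup f _ _)
  map_inf' _ _ := Subtype.ext (map_inf f _ _)
  map_bot' := Subtype.ext (map_bot f)
  map_himp' a b := Subtype.ext <| by
    change f (int ((a : A)ᶜ ⊔ b)) = int ((f a)ᶜ ⊔ f b)
    rw [map_int, map_sup, map_compl']

theorem coe_openHom (f : InteriorHom A B) (a : opens A) : (openHom f a : B) = f a := rfl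

theorem injective_openHom {f : InteriorHom A B} (hf : Function.Injective f) :
    Function.Injective (openHom f) :=
  fun _ _ h => Subtype.ext (hf (congrArg Subtype.val h))

theorem IsStarAlgebra.openHom_injective (hA : IsStarAlgebra A) :
    Function.Injective (openHom : InteriorHom A B → HeytingHom (opens A) (opens B)) := by
  intro f g h
  refine DFunLike.ext f g (hA.induction (fun a ha => ?_) (fun a ha => ?_) fun a b ha hb => ?_)
  · exact congrArg Subtype.val (DFunLike.congr_fun h (⟨a, ha⟩ : opens A))
  · rw [map_compl', map_compl', ha]
  · rw [map_sup, map_sup, ha, hb]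

theorem IsStarAlgebra.openHom_surjective_iff (hB : IsStarAlgebra B) (f : InteriorHom A B) :
    Function.Surjective (openHom f) ↔ Function.Surjective f := by
  constructor
  · intro h
    refine hB.induction (fun b hb => ?_) ?_ ?_
    · obtain ⟨a, ha⟩ := h ⟨b, hb⟩
      exact ⟨a, congrArg Subtype.val ha⟩
    · rintro _ ⟨a, rfl⟩
      exact ⟨aᶜ, map_compl' f a⟩
    · rintro _ _ ⟨a, rfl⟩ ⟨b, rfl⟩
      exact ⟨a ⊔ b, map_sup f a b⟩
  · intro h b
    obtain ⟨a, ha⟩ := h b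
    refine ⟨⟨int a, int_mem_opens a⟩, Subtype.ext ?_⟩
    rw [coe_openHom, map_int, ha]
    exact b.2

/-- McKinsey and Tarski: an element of the Boolean closure of `L` is a finite meet of elements
`aᶜ ⊔ b` with `a` and `b` in `L`, and `int` preserves finite meets. -/
theorem int_mem_of_mem_closure {L : Set B} (hL : IsSublattice L) (hbot : ⊥ ∈ L) (htop : ⊤ ∈ L)
    (himp : ∀ a ∈ L, ∀ b ∈ L, int (aᶜ ⊔ b) ∈ L) {x : B}
    (hx : x ∈ BooleanSubalgebra.closure L) : int x ∈ L := by
  obtain ⟨t, ht⟩ := (BooleanSubalgebra.mem_closure_iff_sup_sdiff hL hbot htop).1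
    (BooleanSubalgebra.compl_mem hx)
  have hint : int x = t.inf fun p => int ((p.1 : B)ᶜ ⊔ p.2) := by
    calc int x = int (t.inf fun p => (p.1 : B)ᶜ ⊔ p.2) := by
          rw [← compl_compl x, ht, Finset.compl_sup]
          simp only [compl_sdiff, himp_eq, sup_comm]
      _ = _ := Finset.apply_inf_eq_inf_comp int int_inf int_top
  rw [hint]
  exact Finset.inf_mem L htop (fun _ ha _ hb => hL.infClosed ha hb) _ _
    fun p _ => himp _ p.1.2 _ p.2.2

instance : InteriorAlgebra (A × B) where
  int p := (int p.1, int p.2)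
  int_top := Prod.ext int_top int_top
  int_inf _ _ := Prod.ext (int_inf _ _) (int_inf _ _)
  int_le _ := ⟨int_le _, int_le _⟩
  int_int _ := Prod.ext (int_int _) (int_int _)

/-- Functionality of `G` only has to be tested at `⊥`, since `G` is closed under differences. -/
theorem exists_interiorHom_of_graph {G : BooleanSubalgebra (A × B)}
    (hint : ∀ p ∈ G, int p ∈ G) (htotal : ∀ a, ∃ b, (a, b) ∈ G)
    (hbot : ∀ b, (⊥, b) ∈ G → b = ⊥) :
    ∃ f : InteriorHom A B, ∀ a b, (a, b) ∈ G → f a = b := by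
  have hle : ∀ {a b b'}, (a, b) ∈ G → (a, b') ∈ G → b ≤ b' := by
    intro a b b' hb hb'
    have h : (a \ a, b \ b') ∈ G := BooleanSubalgebra.sdiff_mem hb hb'
    rw [sdiff_self] at h
    exact sdiff_eq_bot_iff.1 (hbot _ h)
  have huniq : ∀ {a b b'}, (a, b) ∈ G → (a, b') ∈ G → b = b' := fun hb hb' =>
    le_antisymm (hle hb hb') (hle hb' hb)
  choose f hf using htotal
  exact ⟨{
    toFun := f
    map_bot := huniq (hf _) BooleanSubalgebra.bot_mem
    map_top := huniq (hf _) BooleanSubalgebra.top_mem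
    map_inf := fun a b => huniq (hf _) (BooleanSubalgebra.inf_mem (hf a) (hf b))
    map_sup := fun a b => huniq (hf _) (BooleanSubalgebra.sup_mem (hf a) (hf b))
    map_compl := fun a => huniq (hf _) (BooleanSubalgebra.compl_mem (hf a))
    map_int := fun a => huniq (hf _) (hint _ (hf a)) }, fun a _ h => huniq (hf a) h⟩

/-- The graph of a homomorphism between Heyting algebras of open elements. -/
def openGraph (φ : HeytingHom (opens A) (opens B)) : Set (A × B) :=
  Set.range fun a : opens A => ((a : A), (φ a : B))

theorem isSublattice_openGraph (φ : HeytingHom (opens A) (opens B)) :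
    IsSublattice (openGraph φ) where
  supClosed := by
    rintro _ ⟨a, rfl⟩ _ ⟨b, rfl⟩
    exact ⟨a ⊔ b, Prod.ext rfl (congrArg Subtype.val (map_sup φ a b))⟩
  infClosed := by
    rintro _ ⟨a, rfl⟩ _ ⟨b, rfl⟩
    exact ⟨a ⊓ b, Prod.ext rfl (congrArg Subtype.val (map_inf φ a b))⟩

theorem bot_mem_openGraph (φ : HeytingHom (opens A) (opens B)) : ⊥ ∈ openGraph φ :=
  ⟨⊥, Prod.ext rfl (congrArg Subtype.val (map_bot φ))⟩

theorem top_mem_openGraph (φ : HeytingHom (opens A) (opens B)) : ⊤ ∈ openGraph φ :=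
  ⟨⊤, Prod.ext rfl (congrArg Subtype.val (map_top φ))⟩

theorem int_mem_openGraph (φ : HeytingHom (opens A) (opens B)) {p : A × B}
    (hp : p ∈ BooleanSubalgebra.closure (openGraph φ)) : int p ∈ openGraph φ := by
  refine int_mem_of_mem_closure (isSublattice_openGraph φ) (bot_mem_openGraph φ)
    (top_mem_openGraph φ) ?_ hp
  rintro _ ⟨a, rfl⟩ _ ⟨b, rfl⟩
  exact ⟨a ⇨ b, Prod.ext rfl (congrArg Subtype.val (map_himp φ a b))⟩

theorem eq_bot_of_mem_closure_openGraph (φ : HeytingHom (opens A) (opens B)) {b : B}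
    (hb : (⊥, b) ∈ BooleanSubalgebra.closure (openGraph φ)) : b = ⊥ := by
  obtain ⟨a, ha⟩ := int_mem_openGraph φ (BooleanSubalgebra.compl_mem hb)
  have ha_top : a = ⊤ := Subtype.ext <| by
    calc (a : A) = int (⊥ : A)ᶜ := congrArg Prod.fst ha
      _ = ⊤ := by rw [compl_bot, int_top]
  have hint : int bᶜ = ⊤ := by
    calc int bᶜ = φ a := (congrArg Prod.snd ha).symm
      _ = ⊤ := by rw [ha_top, map_top]; rfl
  exact compl_eq_top.1 (top_le_iff.1 (hint.symm.le.trans (int_le _)))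

theorem IsStarAlgebra.openHom_surjective (hA : IsStarAlgebra A) :
    Function.Surjective (openHom : InteriorHom A B → HeytingHom (opens A) (opens B)) := by
  intro φ
  let G := BooleanSubalgebra.closure (openGraph φ)
  have hmem : ∀ a : opens A, ((a : A), (φ a : B)) ∈ G := fun a =>
    BooleanSubalgebra.subset_closure ⟨a, rfl⟩
  have htotal : ∀ a, ∃ b, (a, b) ∈ G := by
    refine hA.induction (fun a ha => ⟨_, hmem ⟨a, ha⟩⟩) ?_ ?_
    · rintro a ⟨b, hb⟩
      exact ⟨bᶜ, BooleanSubalgebra.compl_mem hb⟩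
    · rintro a a' ⟨b, hb⟩ ⟨b', hb'⟩
      exact ⟨b ⊔ b', BooleanSubalgebra.sup_mem hb hb'⟩
  obtain ⟨f, hf⟩ := exists_interiorHom_of_graph
    (fun _ hp => BooleanSubalgebra.subset_closure (int_mem_openGraph φ hp)) htotal
    (fun _ => eq_bot_of_mem_closure_openGraph φ)
  exact ⟨f, DFunLike.ext _ _ fun a => Subtype.ext (hf _ _ (hmem a))⟩

end OpenHom

end InteriorAlgebra

namespace IntAlg

open InteriorAlgebra

variable {V : Set IntAlg.{u}}

theorem isVariety_isGrzegorczyk : IsVariety {A : IntAlg.{u} | IsGrzegorczyk A} where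
  image_mem _ hA _ _ hf := IsGrzegorczyk.of_surjective hA hf
  sub_mem _ hA _ _ hf := IsGrzegorczyk.of_injective hA hf
  prod_mem _ _ hA x i := hA i (x i)

theorem IsStarVariety.isGrzegorczyk (hV : IsStarVariety V) {A : IntAlg.{u}} (hA : A ∈ V) :
    IsGrzegorczyk A := by
  rw [hV.2] at hA
  exact hA _ ⟨isVariety_isGrzegorczyk, fun _ hB => hB.2.isGrzegorczyk⟩

theorem IsVariety.isStarVariety (hV : IsVariety V) (hstar : ∀ A ∈ V, IsStarAlgebra A) :
    IsStarVariety V :=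
  ⟨hV, Set.Subset.antisymm (fun A hA _ hW => hW.2 ⟨hA, hstar A hA⟩)
    fun _ hA => hA V ⟨hV, fun _ hB => hB.1⟩⟩

theorem IsLocallyFinite.isStarAlgebra (hV : IsLocallyFinite V) {A : IntAlg.{u}} (hA : A ∈ V)
    (hgrz : IsGrzegorczyk A) : IsStarAlgebra A :=
  hgrz.isStarAlgebra fun x => hV A hA _ (Set.finite_singleton x)

end IntAlg

section QuasiorderEquiv

variable {P Q : Type*} [Preorder P] [Preorder Q] {f : P → Q}

/-- `f` is an equivalence of quasi-ordered sets, that is, it induces an isomorphism of the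
associated partial orders. -/
structure IsQuasiorderEquiv (f : P → Q) : Prop where
  le_iff_le : ∀ x y, f x ≤ f y ↔ x ≤ y
  exists_antisymmRel : ∀ q, ∃ p, AntisymmRel (· ≤ ·) (f p) q

theorem IsQuasiorderEquiv.exists_symm (hf : IsQuasiorderEquiv f) :
    ∃ g : Q → P, IsQuasiorderEquiv g := by
  choose g hg using hf.exists_antisymmRel
  refine ⟨g, fun x y => ?_, fun p => ⟨f p, ?_⟩⟩
  · rw [← hf.le_iff_le, (hg x).le_congr (hg y)]
  · exact ⟨(hf.le_iff_le _ _).1 (hg _).le, (hf.le_iff_le _ _).1 (hg _).ge⟩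

theorem IsMuSet.image {M : Set P} (hM : IsMuSet M) (hf : IsQuasiorderEquiv f) :
    IsMuSet (f '' M) := by
  refine ⟨?_, fun q => ?_⟩
  · rintro _ ⟨x, hx, rfl⟩ _ ⟨y, hy, rfl⟩ hne hle
    exact hne (congrArg f (hM.1.eq hx hy ((hf.le_iff_le x y).1 hle)))
  · obtain ⟨p, hp⟩ := hf.exists_antisymmRel q
    obtain ⟨m, hm, hpm⟩ := hM.2 p
    exact ⟨f m, ⟨m, hm, rfl⟩, hp.ge.trans ((hf.le_iff_le p m).2 hpm)⟩

theorem IsMuSet.injOn {M : Set P} (hM : IsMuSet M) (hf : IsQuasiorderEquiv f) : Set.InjOn f M :=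
  fun x hx y hy h => hM.1.eq hx hy ((hf.le_iff_le x y).1 h.le)

theorem QuasiorderHasType.map {t : UnificationType} (h : QuasiorderHasType P t)
    (hf : IsQuasiorderEquiv f) : QuasiorderHasType Q t := by
  cases t with
  | unitary =>
    obtain ⟨M, hM, hcard⟩ := h
    exact ⟨f '' M, hM.image hf, (hM.injOn hf).ncard_image.trans hcard⟩
  | finitary =>
    obtain ⟨M, hM, hfin, hcard⟩ := h
    exact ⟨f '' M, hM.image hf, hfin.image f, hcard.trans_eq (hM.injOn hf).ncard_image.symm⟩
  | infinitary =>
    obtain ⟨M, hM, hinf⟩ := h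
    exact ⟨f '' M, hM.image hf, hinf.image (hM.injOn hf)⟩
  | nullary =>
    obtain ⟨g, hg⟩ := hf.exists_symm
    exact fun ⟨N, hN⟩ => h ⟨g '' N, hN.image hg⟩

theorem IsQuasiorderEquiv.quasiorderHasType_iff (hf : IsQuasiorderEquiv f) (t : UnificationType) :
    QuasiorderHasType P t ↔ QuasiorderHasType Q t := by
  obtain ⟨g, hg⟩ := hf.exists_symm
  exact ⟨fun h => h.map hf, fun h => h.map hg⟩

end QuasiorderEquiv

section UnifierTypes

variable {C : Type (u + 1)} [Category.{u} C] {FC : C → C → Type u} {CC : C → Type u}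
  [∀ X Y, FunLike (FC X Y) (CC X) (CC Y)] [ConcreteCategory C FC] [HasTerms C]

/-- The types of the unifiable members of `V`, which determine the unification type of `V`. -/
def unifierTypes (V : Set C) : Set UnificationType :=
  {t | ∃ A, IsUnifiableIn V A ∧ QuasiorderHasType (Unifier V A) t}

theorem unifierTypes_subset_iff {V : Set C} {S : Set UnificationType} :
    unifierTypes V ⊆ S ↔ ∀ A, IsUnifiableIn V A → ∃ t ∈ S, QuasiorderHasType (Unifier V A) t := by
  refine ⟨fun h A hA => ?_, fun h t ⟨A, hA, ht⟩ => ?_⟩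
  · have : Nonempty (Unifier V A) := hA.2
    obtain ⟨t, ht⟩ := QuasiorderHasType.exists (P := Unifier V A)
    exact ⟨t, h ⟨A, hA, ht⟩, ht⟩
  · obtain ⟨s, hs, hs'⟩ := h A hA
    rwa [ht.unique hs']

theorem hasUnificationType_iff {V : Set C} {t : UnificationType} :
    HasUnificationType V t ↔
      match t with
      | .unitary => unifierTypes V ⊆ {.unitary}
      | .finitary => unifierTypes V ⊆ {.unitary, .finitary} ∧ .finitary ∈ unifierTypes V
      | .infinitary =>
          unifierTypes V ⊆ {.unitary, .finitary, .infinitary} ∧ .infinitary ∈ unifierTypes V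
      | .nullary => .nullary ∈ unifierTypes V := by
  cases t <;>
    simp only [HasUnificationType, unifierTypes_subset_iff, Set.mem_insert_iff,
      Set.mem_singleton_iff, or_and_right, exists_or, exists_eq_left] <;> rfl

end UnifierTypes

section FiniteHulls

variable {C : Type (u + 1)} [Category.{u} C] {FC : C → C → Type u} {CC : C → Type u}
  [∀ X Y, FunLike (FC X Y) (CC X) (CC Y)] [ConcreteCategory C FC]

/-- A local finiteness condition on the class `V`: each finite tuple of elements of a member of
`V` lies in the image of a finite member of `V` under an injective homomorphism. -/
def HasFiniteHulls (V : Set C) : Prop :=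
  ∀ A ∈ V, ∀ (n : ℕ) (a : Fin n → CC A), ∃ S ∈ V, Finite (CC S) ∧
    ∃ j : S ⟶ A, Function.Injective (ConcreteCategory.hom j) ∧
      ∀ k, a k ∈ Set.range (ConcreteCategory.hom j)

variable [HasTerms C]

variable (C) in
/-- Homomorphisms commute with the evaluation of terms. This law is not part of `HasTerms`. -/
class HasNaturalTerms : Prop where
  map_eval {A B : C} (f : A ⟶ B) {X : Type} (a : X → CC A) (t : HasTerms.Term C X) :
    ConcreteCategory.hom f (HasTerms.eval A a t) =
      HasTerms.eval B (fun x => ConcreteCategory.hom f (a x)) t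

variable [HasNaturalTerms C] {V : Set C} {A B : C}

theorem Satisfies.of_injective {X : Type} {a : X → CC A}
    {E : Set (HasTerms.Term C X × HasTerms.Term C X)} {f : A ⟶ B}
    (hf : Function.Injective (ConcreteCategory.hom f))
    (h : Satisfies B (fun x => ConcreteCategory.hom f (a x)) E) : Satisfies A a E := by
  intro p hp
  apply hf
  rw [HasNaturalTerms.map_eval, HasNaturalTerms.map_eval, h p hp]

/-- A finite hull `j : S ⟶ A` of the generators satisfies their relations. So there is a
homomorphism `A ⟶ S` fixing the generators, and it is a section of `j`. -/
theorem IsFinitelyPresentedIn.finite (hV : HasFiniteHulls V) (hA : IsFinitelyPresentedIn V A) :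
    Finite (CC A) := by
  obtain ⟨hAV, n, E, a, -, haE, huniv⟩ := hA
  obtain ⟨S, hSV, _, j, hj, hrange⟩ := hV A hAV n a
  choose s hs using hrange
  obtain rfl : (fun k => ConcreteCategory.hom j (s k)) = a := funext hs
  obtain ⟨r, hr, -⟩ := huniv S hSV s (haE.of_injective hj)
  have hsection : r ≫ j = 𝟙 A :=
    (huniv A hAV _ haE).unique (fun k => by rw [ConcreteCategory.comp_apply, hr])
      (fun k => ConcreteCategory.id_apply _)
  refine Finite.of_surjective (ConcreteCategory.hom j) fun x => ⟨ConcreteCategory.hom r x, ?_⟩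
  rw [← ConcreteCategory.comp_apply, hsection, ConcreteCategory.id_apply]

end FiniteHulls

section UnificationEquivalence

universe v

variable {C : Type (u + 1)} [Category.{u} C] {FC : C → C → Type u} {CC : C → Type u}
  [∀ X Y, FunLike (FC X Y) (CC X) (CC Y)] [ConcreteCategory C FC] [HasTerms C]
  {D : Type (v + 1)} [Category.{v} D] {FD : D → D → Type v} {CD : D → Type v}
  [∀ X Y, FunLike (FD X Y) (CD X) (CD Y)] [ConcreteCategory D FD] [HasTerms D]

/-- `F` restricts to an equivalence between (the full subcategories on) the classes `V` and `W`
which preserves the notions entering into the definition of unification types: surjectivity and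
finite presentability. -/
structure IsUnificationEquivalence (F : C ⥤ D) (V : Set C) (W : Set D) : Prop where
  mem_iff : ∀ L, L ∈ W ↔ ∃ A ∈ V, Nonempty (L ≅ F.obj A)
  map_bijective : ∀ A ∈ V, ∀ B ∈ V, Function.Bijective (F.map : (A ⟶ B) → (F.obj A ⟶ F.obj B))
  surjective_map_iff : ∀ A ∈ V, ∀ B ∈ V, ∀ f : A ⟶ B,
    Function.Surjective (ConcreteCategory.hom (F.map f)) ↔
      Function.Surjective (ConcreteCategory.hom f)
  isFinitelyPresentedIn_iff : ∀ A ∈ V, ∀ L, Nonempty (L ≅ F.obj A) →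
    (IsFinitelyPresentedIn W L ↔ IsFinitelyPresentedIn V A)

namespace IsUnificationEquivalence

variable {F : C ⥤ D} {V : Set C} {W : Set D} {A B : C} {L : D}

theorem exists_map_eq (h : IsUnificationEquivalence F V W) (hA : A ∈ V) (hB : B ∈ V)
    (φ : F.obj A ⟶ F.obj B) : ∃ f : A ⟶ B, F.map f = φ :=
  (h.map_bijective A hA B hB).surjective φ

theorem map_injective (h : IsUnificationEquivalence F V W) (hA : A ∈ V) (hB : B ∈ V) :
    Function.Injective (F.map : (A ⟶ B) → (F.obj A ⟶ F.obj B)) :=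
  (h.map_bijective A hA B hB).injective

theorem obj_mem (h : IsUnificationEquivalence F V W) (hA : A ∈ V) : F.obj A ∈ W :=
  (h.mem_iff _).2 ⟨A, hA, ⟨Iso.refl _⟩⟩

theorem isProjectiveIn_of_iso (h : IsUnificationEquivalence F V W) (hA : IsProjectiveIn V A)
    (i : L ≅ F.obj A) : IsProjectiveIn W L := by
  refine ⟨(h.mem_iff L).2 ⟨A, hA.1, ⟨i⟩⟩, fun K hK M hM e φ he => ?_⟩
  obtain ⟨B, hB, ⟨iB⟩⟩ := (h.mem_iff K).1 hK
  obtain ⟨B', hB', ⟨iB'⟩⟩ := (h.mem_iff M).1 hM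
  obtain ⟨e', he'⟩ := h.exists_map_eq hB hB' (iB.inv ≫ e ≫ iB'.hom)
  obtain ⟨f, hf⟩ := h.exists_map_eq hA.1 hB' (i.inv ≫ φ ≫ iB'.hom)
  have hsurj : Function.Surjective (ConcreteCategory.hom e') := by
    have hcomp : ⇑(ConcreteCategory.hom (F.map e')) = ConcreteCategory.hom iB'.hom ∘
        ConcreteCategory.hom e ∘ ConcreteCategory.hom iB.inv := by
      ext x
      simp only [he', ConcreteCategory.comp_apply, Function.comp_apply]
    rw [← h.surjective_map_iff B hB B' hB', hcomp]
    exact (ConcreteCategory.bijective_of_isIso iB'.hom).surjective.comp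
      (he.comp (ConcreteCategory.bijective_of_isIso iB.inv).surjective)
  obtain ⟨g, rfl⟩ := hA.2 B hB B' hB' e' f hsurj
  refine ⟨i.hom ≫ F.map g ≫ iB.inv, ?_⟩
  rw [F.map_comp, he'] at hf
  rw [← cancel_epi i.inv, ← cancel_mono iB'.hom]
  simpa only [Category.assoc, Iso.inv_hom_id_assoc] using hf

theorem isProjectiveIn_of_iso_obj (h : IsUnificationEquivalence F V W) (hL : IsProjectiveIn W L)
    (hA : A ∈ V) (i : L ≅ F.obj A) : IsProjectiveIn V A := by
  refine ⟨hA, fun B hB B' hB' e f he => ?_⟩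
  obtain ⟨φ, hφ⟩ := hL.2 _ (h.obj_mem hB) _ (h.obj_mem hB') (F.map e) (i.hom ≫ F.map f)
    ((h.surjective_map_iff B hB B' hB' e).2 he)
  obtain ⟨g, hg⟩ := h.exists_map_eq hA hB (i.inv ≫ φ)
  refine ⟨g, h.map_injective hA hB' ?_⟩
  rw [F.map_comp, hg, Category.assoc, hφ, Iso.inv_hom_id_assoc]

/-- The unifier for `L ≅ F.obj A` induced by a unifier for `A`. -/
def mapUnifier (h : IsUnificationEquivalence F V W) (i : L ≅ F.obj A) (v : Unifier V A) :
    Unifier W L where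
  target := F.obj v.target
  finitelyPresented := (h.isFinitelyPresentedIn_iff _ v.projective.1 _ ⟨Iso.refl _⟩).2
    v.finitelyPresented
  projective := h.isProjectiveIn_of_iso v.projective (Iso.refl _)
  hom := i.hom ≫ F.map v.hom

theorem mapUnifier_le_iff (h : IsUnificationEquivalence F V W) (hA : A ∈ V) (i : L ≅ F.obj A)
    (v w : Unifier V A) : h.mapUnifier i v ≤ h.mapUnifier i w ↔ v ≤ w := by
  constructor
  · rintro ⟨φ, hφ⟩
    obtain ⟨f, rfl⟩ := h.exists_map_eq w.projective.1 v.projective.1 φ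
    refine ⟨f, h.map_injective hA v.projective.1 ?_⟩
    rw [F.map_comp, ← cancel_epi i.hom, ← Category.assoc]
    exact hφ
  · rintro ⟨f, hf⟩
    refine ⟨F.map f, ?_⟩
    simp only [mapUnifier, Category.assoc, ← F.map_comp, hf]

theorem exists_antisymmRel_mapUnifier (h : IsUnificationEquivalence F V W) (hA : A ∈ V)
    (i : L ≅ F.obj A) (w : Unifier W L) :
    ∃ v : Unifier V A, AntisymmRel (· ≤ ·) (h.mapUnifier i v) w := by
  obtain ⟨B, hB, ⟨iB⟩⟩ := (h.mem_iff _).1 w.projective.1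
  obtain ⟨f, hf⟩ := h.exists_map_eq hA hB (i.inv ≫ w.hom ≫ iB.hom)
  have hhom : i.hom ≫ F.map f = w.hom ≫ iB.hom := by rw [hf, Iso.hom_inv_id_assoc]
  refine ⟨⟨B, (h.isFinitelyPresentedIn_iff B hB _ ⟨iB⟩).1 w.finitelyPresented,
    h.isProjectiveIn_of_iso_obj w.projective hB iB, f⟩, ⟨iB.hom, hhom.symm⟩, ⟨iB.inv, ?_⟩⟩
  simp only [mapUnifier, hhom, Category.assoc, Iso.hom_inv_id, Category.comp_id]

theorem isQuasiorderEquiv_mapUnifier (h : IsUnificationEquivalence F V W) (hA : A ∈ V)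
    (i : L ≅ F.obj A) : IsQuasiorderEquiv (h.mapUnifier i : Unifier V A → Unifier W L) :=
  ⟨h.mapUnifier_le_iff hA i, h.exists_antisymmRel_mapUnifier hA i⟩

theorem isUnifiableIn_iff (h : IsUnificationEquivalence F V W) (hA : A ∈ V)
    (i : L ≅ F.obj A) : IsUnifiableIn W L ↔ IsUnifiableIn V A :=
  and_congr (h.isFinitelyPresentedIn_iff A hA L ⟨i⟩)
    ⟨fun ⟨w⟩ => ⟨(h.exists_antisymmRel_mapUnifier hA i w).choose⟩,
      fun ⟨v⟩ => ⟨h.mapUnifier i v⟩⟩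

theorem unifierTypes_eq (h : IsUnificationEquivalence F V W) :
    unifierTypes V = unifierTypes W := by
  ext t
  constructor
  · rintro ⟨A, hA, ht⟩
    have hAV : A ∈ V := hA.1.1
    exact ⟨F.obj A, (h.isUnifiableIn_iff hAV (Iso.refl _)).2 hA,
      ((h.isQuasiorderEquiv_mapUnifier hAV (Iso.refl _)).quasiorderHasType_iff t).1 ht⟩
  · rintro ⟨L, hL, ht⟩
    obtain ⟨A, hA, ⟨i⟩⟩ := (h.mem_iff L).1 hL.1.1
    exact ⟨A, (h.isUnifiableIn_iff hA i).1 hL,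
      ((h.isQuasiorderEquiv_mapUnifier hA i).quasiorderHasType_iff t).2 ht⟩

theorem unificationType_eq (h : IsUnificationEquivalence F V W) :
    unificationType V = unificationType W := by
  rw [unificationType_eq_iff, hasUnificationType_iff, h.unifierTypes_eq, ← hasUnificationType_iff,
    ← unificationType_eq_iff]

end IsUnificationEquivalence

end UnificationEquivalence

section Diagrams

theorem HeytTerm.map_eval {L M : Type u} [HeytingAlgebra L] [HeytingAlgebra M]
    (f : HeytingHom L M) {X : Type} (a : X → L) (t : HeytTerm X) :
    f (t.eval a) = t.eval fun x => f (a x) := by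
  induction t with
  | var x => rfl
  | bot => exact map_bot f
  | top => exact map_top f
  | inf s t hs ht => simp only [eval, map_inf, hs, ht]
  | sup s t hs ht => simp only [eval, map_sup, hs, ht]
  | imp s t hs ht => simp only [eval, map_himp, hs, ht]

theorem IntTerm.map_eval {A B : Type u} [InteriorAlgebra A] [InteriorAlgebra B]
    (f : InteriorHom A B) {X : Type} (a : X → A) (t : IntTerm X) :
    f (t.eval a) = t.eval fun x => f (a x) := by
  induction t with
  | var x => rfl
  | bot => exact map_bot f
  | top => exact map_top f
  | inf s t hs ht => simp only [eval, map_inf, hs, ht]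
  | sup s t hs ht => simp only [eval, map_sup, hs, ht]
  | compl t ht => simp only [eval, map_compl', ht]
  | int t ht => simp only [eval, InteriorAlgebra.map_int, ht]

instance : HasNaturalTerms HeytAlg.{u} where
  map_eval f := HeytTerm.map_eval f.hom

instance : HasNaturalTerms IntAlg.{u} where
  map_eval := IntTerm.map_eval

/-- The operation tables of a Heyting algebra with elements named by `e`, as equations. -/
def heytDiagram {L : Type u} [HeytingAlgebra L] {X : Type} (e : L → X) :
    Set (HeytTerm X × HeytTerm X) :=
  {(.bot, .var (e ⊥)), (.top, .var (e ⊤))} ∪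
  ((Set.range fun p : L × L => (.inf (.var (e p.1)) (.var (e p.2)), .var (e (p.1 ⊓ p.2)))) ∪
  ((Set.range fun p : L × L => (.sup (.var (e p.1)) (.var (e p.2)), .var (e (p.1 ⊔ p.2)))) ∪
  (Set.range fun p : L × L => (.imp (.var (e p.1)) (.var (e p.2)), .var (e (p.1 ⇨ p.2))))))

/-- The operation tables of an interior algebra with elements named by `e`, as equations. -/
def intDiagram {B : Type u} [InteriorAlgebra B] {X : Type} (e : B → X) :
    Set (IntTerm X × IntTerm X) :=
  {(.bot, .var (e ⊥)), (.top, .var (e ⊤))} ∪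
  ((Set.range fun p : B × B => (.inf (.var (e p.1)) (.var (e p.2)), .var (e (p.1 ⊓ p.2)))) ∪
  ((Set.range fun p : B × B => (.sup (.var (e p.1)) (.var (e p.2)), .var (e (p.1 ⊔ p.2)))) ∪
  ((Set.range fun a : B => (.compl (.var (e a)), .var (e aᶜ))) ∪
  (Set.range fun a : B => (.int (.var (e a)), .var (e (InteriorAlgebra.int a)))))))

theorem finite_heytDiagram {L : Type u} [HeytingAlgebra L] [Finite L] {X : Type} (e : L → X) :
    (heytDiagram e).Finite :=
  (Set.toFinite _).union
    ((Set.finite_range _).union ((Set.finite_range _).union (Set.finite_range _)))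

theorem finite_intDiagram {B : Type u} [InteriorAlgebra B] [Finite B] {X : Type} (e : B → X) :
    (intDiagram e).Finite :=
  (Set.toFinite _).union ((Set.finite_range _).union ((Set.finite_range _).union
    ((Set.finite_range _).union (Set.finite_range _))))

/-- The homomorphism determined by a tuple satisfying the operation tables of `L`. -/
def heytingHomOfSatisfies {L M : HeytAlg.{u}} {X : Type} {e : L → X} {b : X → M}
    (hb : Satisfies M b (heytDiagram e)) : HeytingHom L M where
  toFun x := b (e x)
  map_bot' := (hb _ (.inl (.inl rfl))).symm
  map_inf' x y := (hb _ (.inr (.inl ⟨(x, y), rfl⟩))).symm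
  map_sup' x y := (hb _ (.inr (.inr (.inl ⟨(x, y), rfl⟩)))).symm
  map_himp' x y := (hb _ (.inr (.inr (.inr ⟨(x, y), rfl⟩)))).symm

/-- The homomorphism determined by a tuple satisfying the operation tables of `A`. -/
def interiorHomOfSatisfies {A B : IntAlg.{u}} {X : Type} {e : A → X} {b : X → B}
    (hb : Satisfies B b (intDiagram e)) : InteriorHom A B where
  toFun x := b (e x)
  map_bot := (hb _ (.inl (.inl rfl))).symm
  map_top := (hb _ (.inl (.inr rfl))).symm
  map_inf x y := (hb _ (.inr (.inl ⟨(x, y), rfl⟩))).symm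
  map_sup x y := (hb _ (.inr (.inr (.inl ⟨(x, y), rfl⟩)))).symm
  map_compl x := (hb _ (.inr (.inr (.inr (.inl ⟨x, rfl⟩))))).symm
  map_int x := (hb _ (.inr (.inr (.inr (.inr ⟨x, rfl⟩))))).symm

theorem isFinitelyPresentedIn_heytAlg_of_finite {W : Set HeytAlg.{u}} {L : HeytAlg.{u}}
    (hL : L ∈ W) [Finite L] : IsFinitelyPresentedIn W L := by
  let e := Finite.equivFin L
  refine ⟨hL, Nat.card L, heytDiagram e, e.symm, finite_heytDiagram e, ?_, fun M _ b hb => ?_⟩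
  · rintro _ ((rfl | rfl) | ⟨p, rfl⟩ | ⟨p, rfl⟩ | ⟨p, rfl⟩) <;>
      simp only [HasTerms.eval, HeytTerm.eval, Equiv.symm_apply_apply]
  · refine ⟨HeytAlg.ofHom (heytingHomOfSatisfies hb),
      fun i => congrArg b (e.apply_symm_apply i), fun g hg => HeytAlg.ext fun x => ?_⟩
    exact (congrArg g (e.symm_apply_apply x).symm).trans (hg (e x))

theorem isFinitelyPresentedIn_intAlg_of_finite {V : Set IntAlg.{u}} {A : IntAlg.{u}}
    (hA : A ∈ V) [Finite A] : IsFinitelyPresentedIn V A := by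
  let e := Finite.equivFin A
  refine ⟨hA, Nat.card A, intDiagram e, e.symm, finite_intDiagram e, ?_, fun B _ b hb => ?_⟩
  · rintro _ ((rfl | rfl) | ⟨p, rfl⟩ | ⟨p, rfl⟩ | ⟨a, rfl⟩ | ⟨a, rfl⟩) <;>
      simp only [HasTerms.eval, IntTerm.eval, Equiv.symm_apply_apply]
  · refine ⟨interiorHomOfSatisfies hb, fun i => congrArg b (e.apply_symm_apply i),
      fun g hg => InteriorHom.ext (funext fun x => ?_)⟩
    exact (congrArg g.toFun (e.symm_apply_apply x).symm).trans (hg (e x))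

end Diagrams

namespace IntAlg

open InteriorAlgebra

section OpenFunctor

/-- The functor `O` from interior algebras to Heyting algebras. -/
def openFunctor : IntAlg.{u} ⥤ HeytAlg.{u} where
  obj := openAlgebra
  map f := HeytAlg.ofHom (openHom f)

variable {V : Set IntAlg.{u}}

theorem IsLocallyFinite.hasFiniteHulls (hfin : IsLocallyFinite V) (hV : IsVariety V) :
    HasFiniteHulls V := by
  intro A hA n a
  have hS := isSubalgebra_generated (Set.range a)
  exact ⟨⟨hS.toBooleanSubalgebra⟩, hV.sub_mem A hA _ hS.incl hS.incl_injective,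
    (hfin A hA _ (Set.finite_range a)).to_subtype, hS.incl, hS.incl_injective,
    fun k => ⟨⟨a k, subset_generated _ ⟨k, rfl⟩⟩, rfl⟩⟩

theorem hasFiniteHulls_gamma (hV : HasFiniteHulls V) : HasFiniteHulls (gamma V) := by
  rintro L ⟨A, hA, ⟨i⟩⟩ n a
  let c : Fin n → opens A := fun k => i.hom (a k)
  obtain ⟨S, hS, _, j, hj, hrange⟩ := hV A hA n fun k => (c k : A)
  refine ⟨openAlgebra S, ⟨S, hS, ⟨Iso.refl _⟩⟩, Subtype.finite, openFunctor.map j ≫ i.inv,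
    (ConcreteCategory.bijective_of_isIso i.inv).injective.comp (injective_openHom hj),
    fun k => ?_⟩
  obtain ⟨s, hs⟩ := hrange k
  have hs_open : s ∈ opens S := mem_opens_of_map_mem_opens hj (hs ▸ (c k).2)
  have hs_map : openHom j ⟨s, hs_open⟩ = c k := Subtype.ext hs
  exact ⟨⟨s, hs_open⟩, (congrArg i.inv hs_map).trans (i.hom_inv_id_apply (a k))⟩

theorem isFinitelyPresentedIn_gamma_iff (hV : HasFiniteHulls V) {A : IntAlg.{u}} (hA : A ∈ V)
    (hstar : IsStarAlgebra A) {L : HeytAlg.{u}} (i : L ≅ openAlgebra A) :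
    IsFinitelyPresentedIn (gamma V) L ↔ IsFinitelyPresentedIn V A := by
  let e : L ≃ opens A := Equiv.ofBijective _ (ConcreteCategory.bijective_of_isIso i.hom)
  calc
    IsFinitelyPresentedIn (gamma V) L ↔ Finite L :=
      ⟨fun h => h.finite (hasFiniteHulls_gamma hV),
        fun _ => isFinitelyPresentedIn_heytAlg_of_finite ⟨A, hA, ⟨i⟩⟩⟩
    _ ↔ Finite (opens A) := e.finite_iff
    _ ↔ Finite A := hstar.finite_opens_iff
    _ ↔ IsFinitelyPresentedIn V A :=
      ⟨fun _ => isFinitelyPresentedIn_intAlg_of_finite hA, fun h => h.finite hV⟩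

theorem isUnificationEquivalence_openFunctor (hV : HasFiniteHulls V)
    (hstar : ∀ A ∈ V, IsStarAlgebra A) :
    IsUnificationEquivalence openFunctor V (gamma V) where
  mem_iff _ := Iff.rfl
  map_bijective A hA B _ := by
    constructor
    · exact fun f g h => (hstar A hA).openHom_injective (congrArg HeytAlg.Hom.hom h)
    · intro φ
      obtain ⟨f, hf⟩ := (hstar A hA).openHom_surjective φ.hom
      exact ⟨f, HeytAlg.hom_ext hf⟩
  surjective_map_iff _ _ B hB := (hstar B hB).openHom_surjective_iff
  isFinitelyPresentedIn_iff A hA _ := fun ⟨i⟩ =>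
    isFinitelyPresentedIn_gamma_iff hV hA (hstar A hA) i

end OpenFunctor

end IntAlg

theorem mainTheorem3 (V : Set IntAlg.{u}) (hV : IntAlg.IsVariety V)
    (hfin : IntAlg.IsLocallyFinite V) :
    (IntAlg.IsStarVariety V ↔ ∀ A ∈ V, InteriorAlgebra.IsGrzegorczyk A) ∧
    (IntAlg.IsStarVariety V → unificationType V = unificationType (IntAlg.gamma V)) := by
  refine ⟨⟨fun hs A hA => hs.isGrzegorczyk hA, fun hgrz => ?_⟩, fun hs => ?_⟩
  · exact hV.isStarVariety fun A hA => hfin.isStarAlgebra hA (hgrz A hA)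
  · have hstar : ∀ A ∈ V, InteriorAlgebra.IsStarAlgebra A := fun A hA =>
      hfin.isStarAlgebra hA (hs.isGrzegorczyk hA)
    exact (IntAlg.isUnificationEquivalence_openFunctor (hfin.hasFiniteHulls hV)
      hstar).unificationType_eq
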